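/- A \emph{gyrogroup} is a nonempty set $G$ with a binary operation $\oplus$ having a two-sided identity $0$ and, for each $x$, a two-sided inverse $\ominus x$, such that for all $x,y\in G$ there is an automorphism $\mathrm{gyr}[x,y]$ of $(G,\oplus)$ with $x\oplus(y\oplus z)=(x\oplus y)\oplus \mathrm{gyr}[x,y](z)$ for all $z\in G$, and $\mathrm{gyr}[x\oplus y,y]=\mathrm{gyr}[x,y]$. A \emph{strongly topological gyrogroup} is a gyrogroup with a topology for which $\oplus$ is jointly continuous and $\ominus$ is continuous, and which has a neighborhood base $\mathscr U$ at $0$ with $\mathrm{gyr}[x,y](U)=U$ for all $U\in\mathscr U$ and $x,y\in G$. A subset $H\subseteq G$ is a \emph{strong subgyrogroup} if it is nonempty, closed under $\oplus$ and $\ominus$, and $\mathrm{gyr}[x,y](H)=H$ for all $x,y\in G$. It is \emph{inner neutral} if for every open neighborhood $U$ of $0$ there is an open neighborhood $V$ of $0$ with $H\oplus V\subseteq U\oplus H$. The coset space $G/H=\{a\oplus H:a\in G\}$ carries the quotient topology of the map $a\mapsto a\oplus H$. Let $X$ be a topological space. \begin{itemize} \item A \emph{prefilter} on $X$ is a family $\zeta$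 of nonempty subsets of $X$ such that for all $P_1,P_2\in\zeta$ some $P\in\zeta$ satisfies $P\subseteq P_1\cap P_2$. The space $X$ is \emph{bisequential} if for every $x\in X$ and every prefilter $\zeta$ with $x\in\overline{P}$ for all $P\in\zeta$ there is a countable prefilter $\eta$ such that every open neighborhood of $x$ contains a member of $\eta$, and $P\cap Q\neq\emptyset$ for all $P\in\zeta$, $Q\in\eta$. \item $X$ is \emph{weakly first-countable} if to each $x\in X$ one can assign sets $B(n,x)\ni x$ $(n\in\mathbb N)$ with $B(n+1,x)\subseteq B(n,x)$ such that a set $U\subseteq X$ is open if and only if for each $x\in U$ there is $n$ with $B(n,x)\subseteq U$. \item $X$ is \emph{csf-countable} if each $x\in X$ has a countable family $\mathscr P$ of subsets of $X$ containing $x$ such that, for every sequence $L$ converging to $x$ and every neighborhood $U$ of $x$, there is $P\in\mathscr P$ with $P\subseteq U$ and $L$ eventually in $P$. \item $X$ is \emph{sequential} if every non-closed $A\subseteq X$ contains a sequence converging to a point of $X\setminus A$. \item $X$ is an \emph{$\alpha_7$-space} if for every $x\in X$ and all sequences $S_n$ $(n\in\omega)$ in $X$ converging to $x$ there is a sequence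 in $X$ that converges to some point $y\in X$ and meets infinitely many of the $S_n$. \end{itemize} \textbf{Corollary.} Let $G$ be a Hausdorff strongly topological gyrogroup and $H$ a closed, inner neutral strong subgyrogroup of $G$. Then the following are equivalent: (1) $G/H$ is first-countable; (2) $G/H$ is bisequential; (3) $G/H$ is weakly first-countable; (4) $G/H$ is a csf-countable sequential $\alpha_7$-space. -/

import Mathlib

open Set Filter Topology
open scoped Pointwise

/-- A gyrogroup, with its operation `⊕` written `+`, its identity `0` and its inversion `⊖` written
`-`. The gyrations are automorphisms of the groupoid `(G, +)`. Left cancellation follows from the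
axioms, so the identity, the inverses and the gyrations are uniquely determined by the operation. -/
class Gyrogroup (G : Type*) extends Add G, Zero G, Neg G where
  zero_add' : ∀ a : G, 0 + a = a
  add_zero' : ∀ a : G, a + 0 = a
  neg_add' : ∀ a : G, -a + a = 0
  add_neg' : ∀ a : G, a + -a = 0
  /-- The gyration `gyr[x, y]`. -/
  gyr : G → G → (G ≃+ G)
  add_add_gyr : ∀ x y z : G, x + (y + z) = (x + y) + gyr x y z
  gyr_loop : ∀ x y : G, gyr (x + y) y = gyr x y

namespace Gyrogroup

/-- A topological gyrogroup: the operation is jointly continuous and the inversion is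
continuous. -/
class IsTopologicalGyrogroup (G : Type*) [TopologicalSpace G] [Gyrogroup G] : Prop where
  continuous_add' : Continuous fun p : G × G => p.1 + p.2
  continuous_neg' : Continuous fun a : G => -a

/-- A strongly topological gyrogroup: a topological gyrogroup with a neighborhood base at `0` whose
members are invariant under all gyrations. -/
class IsStronglyTopologicalGyrogroup (G : Type*) [TopologicalSpace G] [Gyrogroup G] : Prop
    extends IsTopologicalGyrogroup G where
  exists_invariant_base : ∃ 𝒰 : Set (Set G),
    (∀ U ∈ 𝒰, U ∈ 𝓝 (0 : G)) ∧ (∀ N ∈ 𝓝 (0 : G), ∃ U ∈ 𝒰, U ⊆ N) ∧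
      ∀ U ∈ 𝒰, ∀ x y : G, gyr x y '' U = U

section Subsets

variable {G : Type*} [Gyrogroup G]

/-- A subgyrogroup: a nonempty subset that is a gyrogroup under the inherited operation (that is,
it is closed under the operation and inversion), on which every `gyr[a, b]` with `a, b ∈ H`
restricts to an automorphism. -/
structure IsSubgyrogroup (H : Set G) : Prop where
  nonempty : H.Nonempty
  add_mem : ∀ a ∈ H, ∀ b ∈ H, a + b ∈ H
  neg_mem : ∀ a ∈ H, -a ∈ H
  gyr_image : ∀ a ∈ H, ∀ b ∈ H, gyr a b '' H = H

/-- A strong subgyrogroup: a subgyrogroup invariant under all gyrations of `G`. -/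
structure IsStrongSubgyrogroup (H : Set G) : Prop extends IsSubgyrogroup H where
  gyr_image_eq : ∀ x y : G, gyr x y '' H = H

/-- `H` is inner neutral: for every open neighborhood `U` of `0` there is an open neighborhood `V`
of `0` with `H ⊕ V ⊆ U ⊕ H`. The sums are pointwise sums of sets. -/
def IsInnerNeutral [TopologicalSpace G] (H : Set G) : Prop :=
  ∀ U : Set G, IsOpen U → (0 : G) ∈ U → ∃ V : Set G, IsOpen V ∧ (0 : G) ∈ V ∧ H + V ⊆ U + H

/-- The left coset `a ⊕ H`. -/
def leftCoset (H : Set G) (a : G) : Set G := (fun h => a + h) '' H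

/-- The coset space `G/H = {a ⊕ H : a ∈ G}`: two elements of `G` give the same point exactly when
their left cosets are equal. It carries the quotient topology. -/
abbrev CosetSpace (H : Set G) : Type _ := Quotient (Setoid.ker (leftCoset H))

end Subsets

end Gyrogroup

/-- A prefilter: a family of nonempty sets, directed downwards by inclusion. -/
def IsPrefilter {X : Type*} (ζ : Set (Set X)) : Prop :=
  (∀ P ∈ ζ, P.Nonempty) ∧ ∀ P₁ ∈ ζ, ∀ P₂ ∈ ζ, ∃ P ∈ ζ, P ⊆ P₁ ∩ P₂

/-- A family `𝒜` of sets containing `x` is a `cs`-network at `x` if, for every sequence `L`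
converging to `x` and every neighborhood `U` of `x`, the sequence is eventually in some member
of `𝒜` contained in `U`. -/
def IsCsNetworkAt {X : Type*} [TopologicalSpace X] (𝒜 : Set (Set X)) (x : X) : Prop :=
  (∀ P ∈ 𝒜, x ∈ P) ∧ ∀ L : ℕ → X, Tendsto L atTop (𝓝 x) →
    ∀ U ∈ 𝓝 x, ∃ P ∈ 𝒜, (∀ᶠ n in atTop, L n ∈ P) ∧ P ⊆ U

section Spaces

variable (X : Type*) [TopologicalSpace X]

/-- Weak first-countability. -/
def IsWeaklyFirstCountable : Prop :=
  ∃ B : ℕ → X → Set X, (∀ n x, x ∈ B n x) ∧ (∀ n x, B (n + 1) x ⊆ B n x) ∧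
    ∀ U : Set X, IsOpen U ↔ ∀ x ∈ U, ∃ n, B n x ⊆ U

/-- A space is bisequential if for every prefilter `ζ` accumulating to a point `x` there is a
countable prefilter `η` converging to `x` such that every member of `ζ` meets every member
of `η`. -/
def IsBisequential : Prop :=
  ∀ (x : X) (ζ : Set (Set X)), IsPrefilter ζ → (∀ P ∈ ζ, x ∈ closure P) →
    ∃ η : Set (Set X), η.Countable ∧ IsPrefilter η ∧
      (∀ U : Set X, IsOpen U → x ∈ U → ∃ Q ∈ η, Q ⊆ U) ∧
      ∀ P ∈ ζ, ∀ Q ∈ η, (P ∩ Q).Nonempty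

/-- Every point has a countable `cs`-network. -/
def IsCsfCountable : Prop :=
  ∀ x : X, ∃ 𝒜 : Set (Set X), 𝒜.Countable ∧ IsCsNetworkAt 𝒜 x

/-- An `α₇`-space: for every point `x` and every sheaf with vertex `x`, i.e. every family
`(S n)` of sequences converging to `x`, some sequence converging to some point `y` meets infinitely
many of the sequences `S n`. -/
def IsAlphaSeven : Prop :=
  ∀ (x : X) (S : ℕ → ℕ → X), (∀ n, Tendsto (S n) atTop (𝓝 x)) →
    ∃ (y : X) (T : ℕ → X), Tendsto T atTop (𝓝 y) ∧
      {n : ℕ | (range T ∩ range (S n)).Nonempty}.Infinite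

end Spaces

/-! First-countability implies the other conditions in any space; homogeneity gives the converses.
Left translations act transitively on `G/H` but need not form a group, since composing two of them
leaves a gyration. They do preserve closeness measured by gyration-invariant neighborhoods of `0`,
so they lie in the group of homeomorphisms preserving this closeness. Inner neutrality makes
closeness balls shrink to the base coset, and `IsNeutralAction` records the resulting substitutes
for continuity of the group operations. It already forces regularity.

Bisequentiality gives a countable family of nonempty open sets shrinking to the base point; moving a
point of each to the base point yields a base. Conditions (3) and (4) both give a decreasing
sequence of sequential neighborhoods shrinking to the base point, and in a sequential space with a
neutral action these are neighborhoods (`firstCountable_of_isSeqNhd`). For (4) they come from finite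
unions of a closed, stabilizer-invariant `cs`-network (`exists_isSeqNhd_accumulate`). -/

/-- A group of homeomorphisms of `X` that acts transitively and, near the base point `o`,
like the left translations of a coset space over a neutral subgroup. -/
structure IsNeutralAction {X : Type*} [TopologicalSpace X] (Γ : Subgroup (Equiv.Perm X)) (o : X) :
    Prop where
  continuous : ∀ φ ∈ Γ, Continuous φ
  transitive : ∀ x, ∃ φ ∈ Γ, φ o = x
  mapsTo : ∀ N ∈ 𝓝 o, ∃ M ∈ 𝓝 o, ∀ φ ∈ Γ, φ o ∈ M → MapsTo φ M N
  mapsTo_inv : ∀ N ∈ 𝓝 o, ∃ M ∈ 𝓝 o, ∀ φ ∈ Γ, φ o ∈ M → MapsTo (φ⁻¹ : Equiv.Perm X) M N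
  exists_near : ∀ s, ∀ N ∈ 𝓝 s, ∃ A ∈ 𝓝 o, ∀ y ∈ A, ∃ ψ ∈ Γ, ψ y = o ∧ ψ s ∈ N

/-- A set in which every sequence converging to `x` eventually lies. -/
def IsSeqNhd {X : Type*} [TopologicalSpace X] (Q : Set X) (x : X) : Prop :=
  ∀ L : ℕ → X, Tendsto L atTop (𝓝 x) → ∀ᶠ n in atTop, L n ∈ Q

theorem IsSeqNhd.mem {X : Type*} [TopologicalSpace X] {Q : Set X} {x : X} (h : IsSeqNhd Q x) :
    x ∈ Q :=
  (h (fun _ => x) tendsto_const_nhds).exists.choose_spec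

/-! ### Countability and convergence properties of general spaces. -/

section General

variable {X : Type*} [TopologicalSpace X]

theorem isOpen_of_forall_isSeqNhd [SequentialSpace X] {O : Set X}
    (h : ∀ x ∈ O, IsSeqNhd O x) : IsOpen O := by
  rw [← isClosed_compl_iff]
  apply IsSeqClosed.isClosed
  intro L x hL hx hxO
  obtain ⟨n, hn⟩ := (h x hxO L hx).exists
  exact hL n hn

theorem isBisequential_of_firstCountable [FirstCountableTopology X] : IsBisequential X := by
  intro x ζ _ hcl
  obtain ⟨U, hU⟩ := (𝓝 x).exists_antitone_basis
  refine ⟨range U, countable_range U, ⟨?_, ?_⟩, ?_, ?_⟩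
  · rintro _ ⟨n, rfl⟩
    exact ⟨x, mem_of_mem_nhds (hU.1.mem_of_mem trivial)⟩
  · rintro _ ⟨n, rfl⟩ _ ⟨m, rfl⟩
    exact ⟨U (max n m), ⟨_, rfl⟩, subset_inter (hU.2 (le_max_left _ _)) (hU.2 (le_max_right _ _))⟩
  · intro V hV hx
    obtain ⟨n, -, hn⟩ := hU.1.mem_iff.1 (hV.mem_nhds hx)
    exact ⟨U n, ⟨n, rfl⟩, hn⟩
  · rintro P hP _ ⟨n, rfl⟩
    rw [inter_comm]
    exact mem_closure_iff_nhds.1 (hcl P hP) _ (hU.1.mem_of_mem trivial)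

theorem isWeaklyFirstCountable_of_firstCountable [FirstCountableTopology X] :
    IsWeaklyFirstCountable X := by
  choose U hU using fun x : X => (𝓝 x).exists_antitone_basis
  refine ⟨fun n x => U x n, fun n x => mem_of_mem_nhds ((hU x).1.mem_of_mem trivial),
    fun n x => (hU x).2 n.le_succ, fun V => ?_⟩
  rw [isOpen_iff_mem_nhds]
  refine forall₂_congr fun x _ => ?_
  rw [(hU x).1.mem_iff]
  simp

theorem isCsfCountable_of_firstCountable [FirstCountableTopology X] : IsCsfCountable X := by
  intro x
  obtain ⟨U, hU⟩ := (𝓝 x).exists_antitone_basis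
  refine ⟨range U, countable_range U, ?_, ?_⟩
  · rintro _ ⟨n, rfl⟩
    exact mem_of_mem_nhds (hU.1.mem_of_mem trivial)
  · intro L hL V hV
    obtain ⟨n, -, hn⟩ := hU.1.mem_iff.1 hV
    exact ⟨U n, ⟨n, rfl⟩, hL (hU.1.mem_of_mem trivial), hn⟩

theorem isAlphaSeven_of_firstCountable [FirstCountableTopology X] : IsAlphaSeven X := by
  intro x S hS
  obtain ⟨U, hU⟩ := (𝓝 x).exists_antitone_basis
  have h : ∀ n, ∃ k, S n k ∈ U n := fun n =>
    ((hS n).eventually_mem (hU.1.mem_of_mem trivial)).exists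
  choose k hk using h
  refine ⟨x, fun n => S n (k n), hU.tendsto hk, ?_⟩
  have : {n : ℕ | (range (fun n => S n (k n)) ∩ range (S n)).Nonempty} = univ :=
    eq_univ_of_forall fun n => ⟨S n (k n), ⟨n, rfl⟩, ⟨k n, rfl⟩⟩
  rw [this]
  exact infinite_univ

/-- In an `α₇`-space the convergent sequence can be chosen to run through the given sequences. -/
theorem IsAlphaSeven.exists_tendsto (h : IsAlphaSeven X) {x : X} {S : ℕ → ℕ → X}
    (hS : ∀ n, Tendsto (S n) atTop (𝓝 x)) :
    ∃ (y : X) (T : ℕ → X) (n : ℕ → ℕ), Tendsto T atTop (𝓝 y) ∧ Tendsto n atTop atTop ∧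
      ∀ j, T j ∈ range (S (n j)) := by
  obtain ⟨y, T, hT, hJ⟩ := h x S hS
  set J := {n : ℕ | (range T ∩ range (S n)).Nonempty}
  have hτ : ∀ n, ∃ i, n ∈ J → T i ∈ range (S n) := by
    intro n
    by_cases hn : n ∈ J
    · obtain ⟨_, ⟨i, rfl⟩, hi⟩ := hn
      exact ⟨i, fun _ => hi⟩
    · exact ⟨0, fun h => absurd h hn⟩
  choose τ hτ using hτ
  -- If one term lies in infinitely many of the sequences, the constant sequence at it works, with a
  -- new limit; otherwise the chosen indices tend to infinity.
  by_cases hfin : ∃ i, {n ∈ J | τ n = i}.Infinite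
  · obtain ⟨i, hi⟩ := hfin
    refine ⟨T i, fun _ => T i, Nat.nth (· ∈ {n ∈ J | τ n = i}), tendsto_const_nhds,
      (Nat.nth_strictMono hi).tendsto_atTop, fun j => ?_⟩
    obtain ⟨h1, h2⟩ := Nat.nth_mem_of_infinite hi j
    have := hτ _ h1
    rwa [h2] at this
  · push Not at hfin
    have hn := Nat.nth_strictMono hJ
    have hmem := Nat.nth_mem_of_infinite hJ
    refine ⟨y, fun j => T (τ (Nat.nth (· ∈ J) j)), Nat.nth (· ∈ J), hT.comp ?_, hn.tendsto_atTop,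
      fun j => hτ _ (hmem j)⟩
    rw [← Nat.cofinite_eq_atTop]
    refine Tendsto.cofinite_of_finite_preimage_singleton fun i => ?_
    refine ((hfin i).preimage hn.injective.injOn).subset ?_
    intro j hj
    exact ⟨hmem j, hj⟩

/-- Test bisequentiality on the dense open sets: a set meeting all of them is not nowhere dense, so
its closure has interior, and regularity keeps that closure small. -/
theorem IsBisequential.exists_countable_piBase [RegularSpace X] (h : IsBisequential X) (x : X) :
    ∃ 𝒲 : Set (Set X), 𝒲.Countable ∧ (∀ W ∈ 𝒲, IsOpen W ∧ W.Nonempty) ∧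
      ∀ N ∈ 𝓝 x, ∃ W ∈ 𝒲, W ⊆ N := by
  have : Nonempty X := ⟨x⟩
  obtain ⟨η, hη, -, hconv, hmeet⟩ := h x {D | IsOpen D ∧ Dense D}
    ⟨fun D hD => hD.2.nonempty, fun D hD E hE => ⟨D ∩ E, ⟨hD.1.inter hE.1,
      hD.2.inter_of_isOpen_left hE.2 hD.1⟩, Subset.rfl⟩⟩ (fun D hD => hD.2 x)
  refine ⟨(fun Q => interior (closure Q)) '' η, hη.image _, ?_, ?_⟩
  · rintro _ ⟨Q, hQ, rfl⟩
    refine ⟨isOpen_interior, ?_⟩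
    by_contra hne
    rw [not_nonempty_iff_eq_empty, interior_eq_empty_iff_dense_compl] at hne
    obtain ⟨z, hz, hzQ⟩ := hmeet _ ⟨isClosed_closure.isOpen_compl, hne⟩ Q hQ
    exact hz (subset_closure hzQ)
  · intro N hN
    obtain ⟨C, hC, hCc, hCN⟩ := exists_mem_nhds_isClosed_subset hN
    obtain ⟨Q, hQ, hQC⟩ := hconv _ isOpen_interior (mem_interior_iff_mem_nhds.2 hC)
    exact ⟨_, ⟨Q, hQ, rfl⟩, interior_subset.trans
      ((closure_minimal (hQC.trans interior_subset) hCc).trans hCN)⟩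

theorem IsWeaklyFirstCountable.sequentialSpace (h : IsWeaklyFirstCountable X) :
    SequentialSpace X := by
  obtain ⟨B, -, hanti, hopen⟩ := h
  refine ⟨fun A hA => ?_⟩
  rw [← isOpen_compl_iff, hopen]
  intro x hx
  by_contra! hcon
  have hex : ∀ n, ∃ a ∈ B n x, a ∈ A := fun n => by
    simpa [not_subset] using hcon n
  choose a haB haA using hex
  refine hx (hA haA (tendsto_nhds.2 fun U hU hxU => ?_))
  obtain ⟨n, hn⟩ := (hopen U).1 hU x hxU
  filter_upwards [eventually_ge_atTop n] with m hm
  exact hn (antitone_nat_of_succ_le (f := fun n => B n x) (fun n => hanti n x) hm (haB m))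

/-- If a subsequence avoided `B n x`, the complement of its range would be open by the weak base
criterion, because the range together with `x` is compact, hence closed; yet that complement
contains the limit `x`. -/
theorem IsWeaklyFirstCountable.exists_isSeqNhd [T2Space X] (h : IsWeaklyFirstCountable X) (x : X) :
    ∃ Q : ℕ → Set X, Antitone Q ∧ (∀ n, IsSeqNhd (Q n) x) ∧ ∀ N ∈ 𝓝 x, ∃ n, Q n ⊆ N := by
  obtain ⟨B, hmem, hanti, hopen⟩ := h
  refine ⟨fun n => B n x, antitone_nat_of_succ_le fun n => hanti n x, ?_, ?_⟩
  · intro n L hL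
    by_contra hcon
    obtain ⟨σ, hσ, hσB⟩ := extraction_of_frequently_atTop (not_eventually.1 hcon)
    have hLσ : Tendsto (L ∘ σ) atTop (𝓝 x) := hL.comp hσ.tendsto_atTop
    have hx : x ∈ (range (L ∘ σ))ᶜ := by
      rintro ⟨k, hk⟩
      exact hσB k (by rw [show L (σ k) = x from hk]; exact hmem n x)
    have hO : IsOpen (range (L ∘ σ))ᶜ := by
      rw [hopen]
      intro y hy
      by_cases hyx : y = x
      · subst hyx
        refine ⟨n, ?_⟩
        rintro _ hz ⟨k, rfl⟩
        exact hσB k hz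
      · have hcl : IsClosed (insert x (range (L ∘ σ))) := hLσ.isCompact_insert_range.isClosed
        obtain ⟨m, hm⟩ := (hopen _).1 hcl.isOpen_compl y (by
          rintro (h | h)
          exacts [hyx h, hy h])
        exact ⟨m, hm.trans (compl_subset_compl.2 (subset_insert _ _))⟩
    obtain ⟨k, hk⟩ := (hLσ.eventually_mem (hO.mem_nhds hx)).exists
    exact hk ⟨k, rfl⟩
  · intro N hN
    obtain ⟨U, hUN, hU, hxU⟩ := mem_nhds_iff.1 hN
    obtain ⟨n, hn⟩ := (hopen U).1 hU x hxU
    exact ⟨n, hn.trans hUN⟩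

end General

theorem isCountablyGenerated_of_countable_basis {X : Type*} {f : Filter X} {𝒬 : Set (Set X)}
    (hc : 𝒬.Countable) (hmem : ∀ Q ∈ 𝒬, Q ∈ f) (hbase : ∀ N ∈ f, ∃ Q ∈ 𝒬, Q ⊆ N) :
    f.IsCountablyGenerated := by
  refine ⟨𝒬, hc, le_antisymm (le_generate_iff.2 hmem) fun N hN => ?_⟩
  obtain ⟨Q, hQ, hQN⟩ := hbase N hN
  exact mem_of_superset (mem_generate_of_mem hQ) hQN

/-- A stabilizer-invariant set cannot distinguish two group elements that move the same point to the
base point. -/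
theorem apply_mem_of_apply_eq {X : Type*} {Γ : Subgroup (Equiv.Perm X)} {o : X} {F : Set X}
    (hF : ∀ k ∈ Γ, k o = o → MapsTo k F F)
    {φ ψ : Equiv.Perm X} (hφ : φ ∈ Γ) (hψ : ψ ∈ Γ) {y z : X} (hφy : φ y = o) (hψy : ψ y = o)
    (hz : φ z ∈ F) : ψ z ∈ F := by
  have hinv : φ⁻¹ o = y := by rw [← hφy]; simp
  simpa using hF (ψ * φ⁻¹) (Γ.mul_mem hψ (Γ.inv_mem hφ)) (by
    rw [Equiv.Perm.mul_apply, hinv, hψy]) hz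

/-! ### Spaces with a neutral action. -/

namespace IsNeutralAction

variable {X : Type*} [TopologicalSpace X] {Γ : Subgroup (Equiv.Perm X)} {o : X}

theorem tendsto_of_apply_eq (h : IsNeutralAction Γ o) {φ : Equiv.Perm X} (hφ : φ ∈ Γ) {x y : X}
    (hx : φ x = y) : Tendsto φ (𝓝 x) (𝓝 y) :=
  hx ▸ (h.continuous φ hφ).continuousAt

theorem exists_apply_eq (h : IsNeutralAction Γ o) (x : X) : ∃ φ ∈ Γ, φ x = o := by
  obtain ⟨φ, hφ, rfl⟩ := h.transitive x
  exact ⟨φ⁻¹, Γ.inv_mem hφ, by simp⟩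

/-- The neighbourhoods of the base point invariant under its stabilizer form a base. -/
theorem exists_invariant_nhds (h : IsNeutralAction Γ o) {N : Set X} (hN : N ∈ 𝓝 o) :
    ∃ B ∈ 𝓝 o, B ⊆ N ∧ ∀ k ∈ Γ, k o = o → MapsTo k B B := by
  obtain ⟨M, hM, hMN⟩ := h.mapsTo N hN
  refine ⟨{x | ∃ k ∈ Γ, k o = o ∧ ∃ z ∈ M, k z = x},
    mem_of_superset hM fun z hz => ⟨1, Γ.one_mem, rfl, z, hz, rfl⟩, ?_, ?_⟩
  · rintro _ ⟨k, hk, hko, z, hz, rfl⟩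
    exact hMN k hk (by rw [hko]; exact mem_of_mem_nhds hM) hz
  · rintro l hl hlo _ ⟨k, hk, hko, z, hz, rfl⟩
    exact ⟨l * k, Γ.mul_mem hl hk, by simp [hko, hlo], z, hz, rfl⟩

theorem exists_isClosed_nhds (h : IsNeutralAction Γ o) {N : Set X} (hN : N ∈ 𝓝 o) :
    ∃ C ∈ 𝓝 o, IsClosed C ∧ C ⊆ N := by
  obtain ⟨M, hM, hMN⟩ := h.mapsTo N hN
  obtain ⟨B, hB, hBM, hBinv⟩ := h.exists_invariant_nhds hM
  obtain ⟨A, hA, hAB⟩ := h.mapsTo_inv B hB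
  refine ⟨closure M, mem_of_superset hM subset_closure, isClosed_closure, fun z hz => ?_⟩
  obtain ⟨φ, hφ, hφz⟩ := h.exists_apply_eq z
  obtain ⟨b, hb, hbM⟩ := mem_closure_iff_nhds.1 hz _ (h.tendsto_of_apply_eq hφ hφz hA)
  obtain ⟨β, hβ, hβb⟩ := h.transitive b
  obtain ⟨ξ, hξ, hξb⟩ := h.transitive (φ b)
  have h1 : ξ⁻¹ o ∈ B := hAB ξ hξ (by rw [hξb]; exact hb) (mem_of_mem_nhds hA)
  -- This point is `β⁻¹ z`. Both `ξ⁻¹` and `β⁻¹ * φ⁻¹` send `φ b` to `o`, so invariance of `B`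
  -- transfers `h1`; then `β` carries it back to `z`.
  have h2 : (β⁻¹ * φ⁻¹) o ∈ B := by
    refine apply_mem_of_apply_eq (Γ := Γ) (o := o) (y := φ b) hBinv (Γ.inv_mem hξ)
      (Γ.mul_mem (Γ.inv_mem hβ) (Γ.inv_mem hφ)) ?_ ?_ h1
    · simp [← hξb]
    · simp [← hβb]
  have h3 := hMN β hβ (by rwa [hβb]) (hBM h2)
  simpa [← hφz] using h3

theorem regularSpace (h : IsNeutralAction Γ o) : RegularSpace X := by
  refine RegularSpace.of_exists_mem_nhds_isClosed_subset fun x N hN => ?_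
  obtain ⟨φ, hφ, rfl⟩ := h.transitive x
  obtain ⟨C, hC, hCc, hCN⟩ := h.exists_isClosed_nhds (h.tendsto_of_apply_eq hφ rfl hN)
  have hinv : Tendsto (φ⁻¹ : Equiv.Perm X) (𝓝 (φ o)) (𝓝 o) :=
    h.tendsto_of_apply_eq (Γ.inv_mem hφ) (by simp)
  refine ⟨(φ⁻¹ : Equiv.Perm X) ⁻¹' C, hinv hC, hCc.preimage (h.continuous _ (Γ.inv_mem hφ)), ?_⟩
  intro z hz
  simpa using hCN hz

theorem firstCountableTopology (h : IsNeutralAction Γ o) (ho : (𝓝 o).IsCountablyGenerated) :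
    FirstCountableTopology X := by
  refine ⟨fun x => ?_⟩
  obtain ⟨φ, hφ, hx⟩ := h.exists_apply_eq x
  have hinv : φ⁻¹ o = x := by simp [← hx]
  have : 𝓝 x = comap φ (𝓝 o) := by
    refine le_antisymm (h.tendsto_of_apply_eq hφ hx).le_comap ?_
    intro N hN
    refine ⟨_, h.tendsto_of_apply_eq (Γ.inv_mem hφ) hinv hN, fun z hz => ?_⟩
    simpa using hz
  rw [this]
  infer_instance

theorem firstCountable_of_isBisequential (h : IsNeutralAction Γ o) (hX : IsBisequential X) :
    FirstCountableTopology X := by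
  have := h.regularSpace
  obtain ⟨𝒲, h𝒲, hopen, hbase⟩ := hX.exists_countable_piBase o
  have hex : ∀ W : Set X, ∃ w : X, ∃ φ ∈ Γ, φ w = o ∧ (W ∈ 𝒲 → w ∈ W) := by
    intro W
    by_cases hW : W ∈ 𝒲
    · obtain ⟨w, hw⟩ := (hopen W hW).2
      obtain ⟨φ, hφ, hφw⟩ := h.exists_apply_eq w
      exact ⟨w, φ, hφ, hφw, fun _ => hw⟩
    · exact ⟨o, 1, Γ.one_mem, rfl, fun h => absurd h hW⟩
  choose w φ hφ hφw hw using hex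
  refine h.firstCountableTopology (isCountablyGenerated_of_countable_basis
    (h𝒲.image fun W => φ W '' W) ?_ ?_)
  · rintro _ ⟨W, hW, rfl⟩
    have hinv : (φ W)⁻¹ o = w W := by simp [← hφw W]
    refine mem_of_superset (h.tendsto_of_apply_eq (Γ.inv_mem (hφ W)) hinv
      ((hopen W hW).1.mem_nhds (hw W hW))) fun z hz => ⟨_, hz, by simp⟩
  · intro N hN
    obtain ⟨M, hM, hMN⟩ := h.mapsTo_inv N hN
    obtain ⟨W, hW, hWM⟩ := hbase M hM
    refine ⟨_, ⟨W, hW, rfl⟩, ?_⟩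
    rintro _ ⟨z, hz, rfl⟩
    have hinv : (φ W)⁻¹ o = w W := by simp [← hφw W]
    simpa using hMN (φ W)⁻¹ (Γ.inv_mem (hφ W)) (by rw [hinv]; exact hWM (hw W hW)) (hWM hz)

/-- A diagonal sequence turns `mapsTo` into the same statement for the sets `Q n`, which then yields
an open set inside each of them. -/
theorem firstCountable_of_isSeqNhd [SequentialSpace X] (h : IsNeutralAction Γ o)
    {Q : ℕ → Set X} (hanti : Antitone Q) (hQ : ∀ n, IsSeqNhd (Q n) o)
    (hbase : ∀ N ∈ 𝓝 o, ∃ n, Q n ⊆ N) : FirstCountableTopology X := by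
  have key : ∀ n, ∃ m, ∀ φ ∈ Γ, φ o ∈ Q m → MapsTo φ (Q m) (Q n) := by
    intro n
    by_contra! hcon
    have hex : ∀ m, ∃ φ ∈ Γ, φ o ∈ Q m ∧ ∃ z ∈ Q m, φ z ∉ Q n := fun m => by
      simpa [MapsTo] using hcon m
    choose φ hφ hφo z hz hφz using hex
    have hlim : Tendsto (fun m => φ m (z m)) atTop (𝓝 o) := by
      intro N hN
      obtain ⟨M, hM, hMN⟩ := h.mapsTo N hN
      obtain ⟨m, hm⟩ := hbase M hM
      refine mem_map.2 (mem_of_superset (Ici_mem_atTop m) fun l hl => ?_)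
      exact hMN _ (hφ l) (hm (hanti hl (hφo l))) (hm (hanti hl (hz l)))
    obtain ⟨m, hm⟩ := (hQ n _ hlim).exists
    exact hφz m hm
  have hnhds : ∀ n, Q n ∈ 𝓝 o := by
    intro n
    -- A kind of interior of `Q n`: it contains `o`, lies in `Q n` because `o ∈ Q m`, and `key`
    -- makes it sequentially open.
    have hopen : IsOpen {x | ∃ φ ∈ Γ, φ o = x ∧ ∃ m, MapsTo φ (Q m) (Q n)} := by
      refine isOpen_of_forall_isSeqNhd ?_
      rintro _ ⟨φ, hφ, rfl, m, hm⟩ L hL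
      obtain ⟨l, hl⟩ := key m
      have hinv : Tendsto (φ⁻¹ : Equiv.Perm X) (𝓝 (φ o)) (𝓝 o) :=
        h.tendsto_of_apply_eq (Γ.inv_mem hφ) (by simp)
      filter_upwards [hQ l _ (hinv.comp hL)] with j hj
      obtain ⟨β, hβ, hβo⟩ := h.transitive ((φ⁻¹ : Equiv.Perm X) (L j))
      refine ⟨φ * β, Γ.mul_mem hφ hβ, by simp [hβo], l, ?_⟩
      exact hm.comp (hl β hβ (by rw [hβo]; exact hj))
    refine mem_of_superset (hopen.mem_nhds ⟨1, Γ.one_mem, rfl, n, mapsTo_id _⟩) ?_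
    rintro _ ⟨φ, -, rfl, m, hm⟩
    exact hm (hQ m).mem
  refine h.firstCountableTopology
    (isCountablyGenerated_of_countable_basis (countable_range Q) ?_ ?_)
  · rintro _ ⟨n, rfl⟩
    exact hnhds n
  · intro N hN
    obtain ⟨n, hn⟩ := hbase N hN
    exact ⟨_, ⟨n, rfl⟩, hn⟩

/-- Saturating by the stabilizer and closing keeps sets small, since invariant neighborhoods and
closed neighborhoods both form bases at `o`. -/
theorem exists_closed_invariant_csNetwork (h : IsNeutralAction Γ o) (hX : IsCsfCountable X) :
    ∃ ℱ : Set (Set X), ℱ.Countable ∧ IsCsNetworkAt ℱ o ∧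
      ∀ F ∈ ℱ, IsClosed F ∧ ∀ k ∈ Γ, k o = o → MapsTo k F F := by
  have := h.regularSpace
  obtain ⟨𝒜, h𝒜, hmem, hnet⟩ := hX o
  let sat : Set X → Set X := fun P => {x | ∃ k ∈ Γ, k o = o ∧ ∃ z ∈ P, k z = x}
  have hsub : ∀ P, P ⊆ closure (sat P) := fun P z hz =>
    subset_closure ⟨1, Γ.one_mem, rfl, z, hz, rfl⟩
  refine ⟨(fun P => closure (sat P)) '' 𝒜, h𝒜.image _, ⟨?_, ?_⟩, ?_⟩
  · rintro _ ⟨P, hP, rfl⟩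
    exact hsub P (hmem P hP)
  · intro L hL U hU
    obtain ⟨C, hC, hCc, hCU⟩ := exists_mem_nhds_isClosed_subset hU
    obtain ⟨B, hB, hBC, hBinv⟩ := h.exists_invariant_nhds hC
    obtain ⟨P, hP, hLP, hPB⟩ := hnet L hL B hB
    refine ⟨_, ⟨P, hP, rfl⟩, hLP.mono fun n hn => hsub P hn, ?_⟩
    refine (closure_minimal ?_ hCc).trans hCU
    rintro _ ⟨k, hk, hko, z, hz, rfl⟩
    exact hBC (hBinv k hk hko (hPB hz))
  · rintro _ ⟨P, hP, rfl⟩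
    refine ⟨isClosed_closure, fun l hl hlo => MapsTo.closure ?_ (h.continuous l hl)⟩
    rintro _ ⟨k, hk, hko, z, hz, rfl⟩
    exact ⟨l * k, Γ.mul_mem hl hk, by simp [hko, hlo], z, hz, rfl⟩

/-- Otherwise sequences `S n → o` avoid ever larger unions, and `α₇` threads a convergent sequence
through them. Its limit `y` need not be `o`, so tails are cut to make `y` so close to `o` that
moving `y` to `o` keeps each term outside its closed union. -/
theorem exists_isSeqNhd_accumulate (h : IsNeutralAction Γ o) (hX : IsAlphaSeven X)
    {P : ℕ → Set X} (hclosed : ∀ i, IsClosed (P i))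
    (hinv : ∀ i, ∀ k ∈ Γ, k o = o → MapsTo k (P i) (P i))
    (hnet : ∀ L : ℕ → X, Tendsto L atTop (𝓝 o) → ∃ i, ∀ᶠ n in atTop, L n ∈ P i) :
    ∃ n, IsSeqNhd (accumulate P n) o := by
  have := h.regularSpace
  by_contra! hcon
  have hex : ∀ n, ∃ S : ℕ → X, Tendsto S atTop (𝓝 o) ∧ ∀ k, S k ∉ accumulate P n := by
    intro n
    have hn := hcon n
    unfold IsSeqNhd at hn
    push Not at hn
    obtain ⟨L, hL, hn⟩ := hn
    obtain ⟨σ, hσ, hσP⟩ := extraction_of_frequently_atTop hn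
    exact ⟨L ∘ σ, hL.comp hσ.tendsto_atTop, hσP⟩
  choose S hS hSP using hex
  have haccClosed : ∀ n, IsClosed (accumulate P n) := fun n =>
    (finite_le_nat n).isClosed_biUnion fun i _ => hclosed i
  have haccInv : ∀ n, ∀ k ∈ Γ, k o = o → MapsTo k (accumulate P n) (accumulate P n) := by
    intro n k hk hko z hz
    obtain ⟨i, hi, hz⟩ := mem_accumulate.1 hz
    exact mem_accumulate.2 ⟨i, hi, hinv i k hk hko hz⟩
  have hnear : ∀ p : ℕ × ℕ, ∃ A ∈ 𝓝 o, IsClosed A ∧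
      ∀ y ∈ A, ∃ ψ ∈ Γ, ψ y = o ∧ ψ (S p.1 p.2) ∉ accumulate P p.1 := by
    intro p
    obtain ⟨A, hA, hAP⟩ := h.exists_near (S p.1 p.2) _
      ((haccClosed p.1).isOpen_compl.mem_nhds (hSP p.1 p.2))
    obtain ⟨C, hC, hCc, hCA⟩ := exists_mem_nhds_isClosed_subset hA
    exact ⟨C, hC, hCc, fun y hy => hAP y (hCA hy)⟩
  choose A hA hAc hAP using hnear
  -- Coding pairs by integers puts each `A p` into all but finitely many `C n`, so the limit of the
  -- threaded sequence lies in every `A p`.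
  let C : ℕ → Set X := fun n => ⋂ i ∈ {i | i ≤ n}, A (Nat.unpair i)
  have hC : ∀ n, C n ∈ 𝓝 o := fun n =>
    (biInter_mem (finite_le_nat n)).2 fun i _ => hA _
  have htail : ∀ n, ∃ k₀, ∀ k, S n (k + k₀) ∈ C n := by
    intro n
    obtain ⟨k₀, hk₀⟩ := eventually_atTop.1 ((hS n).eventually_mem (hC n))
    exact ⟨k₀, fun k => hk₀ _ (Nat.le_add_left _ _)⟩
  choose k₀ hk₀ using htail
  obtain ⟨y, T, ν, hT, hν, hTS⟩ := hX.exists_tendsto (x := o) (S := fun n k => S n (k + k₀ n))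
    (fun n => (hS n).comp (tendsto_add_atTop_nat (k₀ n)))
  have hy : ∀ p, y ∈ A p := by
    intro p
    refine (hAc p).mem_of_tendsto hT ?_
    filter_upwards [hν.eventually_ge_atTop (Nat.pair p.1 p.2)] with j hj
    obtain ⟨k, hk⟩ := hTS j
    have := mem_iInter₂.1 (hk₀ (ν j) k) (Nat.pair p.1 p.2) hj
    rw [Nat.unpair_pair] at this
    rwa [← hk]
  obtain ⟨φ, hφ, hφy⟩ := h.exists_apply_eq y
  obtain ⟨i, hi⟩ := hnet (fun j => φ (T j)) ((h.tendsto_of_apply_eq hφ hφy).comp hT)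
  obtain ⟨j, hj, hij⟩ := (hi.and (hν.eventually_ge_atTop i)).exists
  obtain ⟨k, hk⟩ := hTS j
  -- `φ` was fixed before the term was known, while `ψ` depends on it; stabilizer invariance makes
  -- the two interchangeable.
  obtain ⟨ψ, hψ, hψy, hψP⟩ := hAP (ν j, k + k₀ (ν j)) y (hy _)
  refine hψP (apply_mem_of_apply_eq (haccInv (ν j)) hφ hψ hφy hψy ?_)
  rw [show S (ν j) (k + k₀ (ν j)) = T j from hk]
  exact mem_accumulate.2 ⟨i, hij, hj⟩

theorem exists_isSeqNhd (h : IsNeutralAction Γ o) (hcsf : IsCsfCountable X)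
    (hα : IsAlphaSeven X) :
    ∃ Q : ℕ → Set X, Antitone Q ∧ (∀ n, IsSeqNhd (Q n) o) ∧ ∀ N ∈ 𝓝 o, ∃ n, Q n ⊆ N := by
  obtain ⟨ℱ, hℱ, hnet, hℱinv⟩ := h.exists_closed_invariant_csNetwork hcsf
  let 𝒮 : Set (Set X) := {Q | IsSeqNhd Q o} ∩ (sUnion '' {s | s.Finite ∧ s ⊆ ℱ})
  have h𝒮 : 𝒮.Countable := ((countable_ofPred_finite_subset hℱ).image _).mono inter_subset_right
  have hbase : ∀ N ∈ 𝓝 o, ∃ Q ∈ 𝒮, Q ⊆ N := by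
    intro N hN
    have hne : {F ∈ ℱ | F ⊆ N}.Nonempty := by
      obtain ⟨F, hF, -, hFN⟩ := hnet.2 (fun _ => o) tendsto_const_nhds N hN
      exact ⟨F, hF, hFN⟩
    obtain ⟨P, hP⟩ := (hℱ.mono (sep_subset ℱ (· ⊆ N))).exists_eq_range hne
    have hPmem : ∀ i, P i ∈ {F ∈ ℱ | F ⊆ N} := fun i => hP ▸ mem_range_self i
    obtain ⟨n, hn⟩ := h.exists_isSeqNhd_accumulate hα (fun i => (hℱinv _ (hPmem i).1).1)
      (fun i => (hℱinv _ (hPmem i).1).2) (fun L hL => by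
        obtain ⟨F, hF, hLF, hFN⟩ := hnet.2 L hL N hN
        obtain ⟨i, rfl⟩ : F ∈ range P := hP ▸ ⟨hF, hFN⟩
        exact ⟨i, hLF⟩)
    refine ⟨accumulate P n, ⟨hn, P '' {i | i ≤ n}, ⟨(finite_le_nat n).image P, ?_⟩, ?_⟩, ?_⟩
    · rintro _ ⟨i, -, rfl⟩
      exact (hPmem i).1
    · rw [sUnion_image]
      rfl
    · exact iUnion₂_subset fun i _ => (hPmem i).2
  obtain ⟨Q₀, hQ₀, -⟩ := hbase univ univ_mem
  obtain ⟨E, hE⟩ := h𝒮.exists_eq_range ⟨Q₀, hQ₀⟩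
  refine ⟨fun n => ⋂ i ∈ {i | i ≤ n}, E i, ?_, ?_, ?_⟩
  · exact fun n m hnm => biInter_subset_biInter_left fun i hi => le_trans hi hnm
  · intro n L hL
    simp only [mem_iInter]
    refine (eventually_all_finite (finite_le_nat n)).2 fun i _ => ?_
    have hEi : E i ∈ 𝒮 := hE ▸ mem_range_self i
    exact hEi.1 L hL
  · intro N hN
    obtain ⟨Q, hQ, hQN⟩ := hbase N hN
    obtain ⟨i, rfl⟩ : Q ∈ range E := hE ▸ hQ
    exact ⟨i, fun x hx => hQN (mem_iInter₂.1 hx i (le_refl i))⟩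

theorem tfae [T1Space X] (h : IsNeutralAction Γ o) : List.TFAE [
    FirstCountableTopology X, IsBisequential X, IsWeaklyFirstCountable X,
    IsCsfCountable X ∧ SequentialSpace X ∧ IsAlphaSeven X] := by
  have := h.regularSpace
  tfae_have 1 → 2 := fun _ => isBisequential_of_firstCountable
  tfae_have 1 → 3 := fun _ => isWeaklyFirstCountable_of_firstCountable
  tfae_have 1 → 4 := fun _ => ⟨isCsfCountable_of_firstCountable, inferInstance,
    isAlphaSeven_of_firstCountable⟩
  tfae_have 2 → 1 := h.firstCountable_of_isBisequential
  tfae_have 3 → 1 := fun hX => by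
    have := hX.sequentialSpace
    obtain ⟨Q, hanti, hQ, hbase⟩ := hX.exists_isSeqNhd o
    exact h.firstCountable_of_isSeqNhd hanti hQ hbase
  tfae_have 4 → 1 := fun ⟨hcsf, _, hα⟩ => by
    obtain ⟨Q, hanti, hQ, hbase⟩ := h.exists_isSeqNhd hcsf hα
    exact h.firstCountable_of_isSeqNhd hanti hQ hbase
  tfae_finish

end IsNeutralAction

/-! ### Gyrogroup algebra and strong subgyrogroups. -/

namespace Gyrogroup

section Algebra

variable {G : Type*} [Gyrogroup G]

theorem add_left_cancel' {a b c : G} (h : a + b = a + c) : b = c := by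
  have h2 : -a + (a + b) = -a + (a + c) := by rw [h]
  simp only [add_add_gyr, neg_add', zero_add'] at h2
  exact (gyr (-a) a).injective h2

theorem gyr_zero (a z : G) : gyr 0 a z = z := by
  have h := add_add_gyr 0 a z
  simp only [zero_add'] at h
  exact (add_left_cancel' h).symm

theorem neg_add_cancel_left' (a b : G) : -a + (a + b) = b := by
  -- The loop property turns `gyr (-a) a` into `gyr 0 a`, which is trivial.
  rw [add_add_gyr, neg_add', zero_add', ← gyr_loop, neg_add', gyr_zero]

theorem neg_neg' (a : G) : - -a = a :=
  add_left_cancel' (a := -a) (by rw [add_neg', neg_add'])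

theorem add_neg_cancel_left' (a b : G) : a + (-a + b) = b := by
  simpa only [neg_neg'] using neg_add_cancel_left' (-a) b

/-- Left translations change differences by a gyration. -/
theorem neg_add_add_add (g x y : G) : -(g + x) + (g + y) = gyr g x (-x + y) := by
  apply add_left_cancel' (a := g + x)
  rw [add_neg_cancel_left', ← add_add_gyr, add_neg_cancel_left']

theorem add_add' (a b c : G) : (a + b) + c = a + (b + (gyr a b).symm c) := by
  rw [add_add_gyr, AddEquiv.apply_symm_apply]

theorem neg_zero' : -(0 : G) = 0 := by
  rw [← zero_add' (-(0 : G)), add_neg']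

end Algebra

namespace IsStrongSubgyrogroup

variable {G : Type*} [Gyrogroup G] {H : Set G}

theorem zero_mem (hH : IsStrongSubgyrogroup H) : (0 : G) ∈ H := by
  obtain ⟨h, hh⟩ := hH.nonempty
  simpa only [neg_add'] using hH.add_mem _ (hH.neg_mem h hh) h hh

theorem gyr_mem (hH : IsStrongSubgyrogroup H) {x y h : G} (hh : h ∈ H) : gyr x y h ∈ H :=
  hH.gyr_image_eq x y ▸ mem_image_of_mem _ hh

theorem gyr_symm_mem (hH : IsStrongSubgyrogroup H) {x y h : G} (hh : h ∈ H) :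
    (gyr x y).symm h ∈ H := by
  rw [← hH.gyr_image_eq x y] at hh
  obtain ⟨k, hk, rfl⟩ := hh
  simpa using hk

/-- Gyration invariance of `H` absorbs the failure of associativity, so left translations descend to
cosets. -/
theorem leftCoset_add (hH : IsStrongSubgyrogroup H) (g a : G) :
    leftCoset H (g + a) = (fun x => g + x) '' leftCoset H a := by
  ext z
  constructor
  · rintro ⟨h, hh, rfl⟩
    exact ⟨_, ⟨_, hH.gyr_symm_mem hh, rfl⟩, (add_add' g a h).symm⟩
  · rintro ⟨_, ⟨h, hh, rfl⟩, rfl⟩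
    exact ⟨_, hH.gyr_mem hh, (add_add_gyr g a h).symm⟩

theorem leftCoset_eq_of_mem (hH : IsStrongSubgyrogroup H) {h : G} (hh : h ∈ H) :
    leftCoset H h = H := by
  ext z
  constructor
  · rintro ⟨k, hk, rfl⟩
    exact hH.add_mem _ hh _ hk
  · intro hz
    exact ⟨-h + z, hH.add_mem _ (hH.neg_mem _ hh) _ hz, add_neg_cancel_left' h z⟩

theorem leftCoset_add_of_mem (hH : IsStrongSubgyrogroup H) (a : G) {h : G} (hh : h ∈ H) :
    leftCoset H (a + h) = leftCoset H a := by
  rw [hH.leftCoset_add, hH.leftCoset_eq_of_mem hh]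
  rfl

theorem leftCoset_eq_iff (hH : IsStrongSubgyrogroup H) {a b : G} :
    leftCoset H a = leftCoset H b ↔ ∃ h ∈ H, a + h = b := by
  constructor
  · intro hab
    have hb : b ∈ leftCoset H b := ⟨0, hH.zero_mem, add_zero' b⟩
    rwa [← hab] at hb
  · rintro ⟨h, hh, rfl⟩
    exact (hH.leftCoset_add_of_mem a hh).symm

end IsStrongSubgyrogroup

/-! ### The coset space and its closeness-preserving homeomorphisms. -/

namespace CosetSpace

variable {G : Type*} [Gyrogroup G] {H : Set G}

/-- The projection onto the coset space. -/
def mk (H : Set G) (a : G) : CosetSpace H := Quotient.mk _ a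

theorem mk_surjective : Function.Surjective (mk H) := Quotient.mk_surjective

theorem mk_eq_mk (hH : IsStrongSubgyrogroup H) {a b : G} :
    mk H a = mk H b ↔ ∃ h ∈ H, a + h = b :=
  Quotient.eq.trans hH.leftCoset_eq_iff

theorem mk_add_of_mem (hH : IsStrongSubgyrogroup H) (a : G) {h : G} (hh : h ∈ H) :
    mk H (a + h) = mk H a :=
  ((mk_eq_mk hH).2 ⟨h, hh, rfl⟩).symm

/-- The left translation by `g` on the coset space. -/
def translate (hH : IsStrongSubgyrogroup H) (g : G) : Equiv.Perm (CosetSpace H) where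
  toFun := Quotient.map (fun x => g + x) fun a b hab => by
    change leftCoset H _ = leftCoset H _
    rw [hH.leftCoset_add, hH.leftCoset_add, show leftCoset H a = leftCoset H b from hab]
  invFun := Quotient.map (fun x => -g + x) fun a b hab => by
    change leftCoset H _ = leftCoset H _
    rw [hH.leftCoset_add, hH.leftCoset_add, show leftCoset H a = leftCoset H b from hab]
  left_inv := by
    rintro ⟨x⟩
    exact congrArg (mk H) (neg_add_cancel_left' g x)
  right_inv := by
    rintro ⟨x⟩
    exact congrArg (mk H) (add_neg_cancel_left' g x)

theorem translate_mk (hH : IsStrongSubgyrogroup H) (g x : G) :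
    translate hH g (mk H x) = mk H (g + x) := rfl

theorem translate_inv (hH : IsStrongSubgyrogroup H) (g : G) :
    (translate hH g)⁻¹ = translate hH (-g) := by
  ext p
  obtain ⟨x, rfl⟩ := mk_surjective p
  rfl

/-- Two cosets are `U`-close if they have representatives whose left difference lies in `U`. -/
def Close (U : Set G) (p q : CosetSpace H) : Prop :=
  ∃ x y, mk H x = p ∧ mk H y = q ∧ -x + y ∈ U

theorem close_zero_iff (hH : IsStrongSubgyrogroup H) {U : Set G} {q : CosetSpace H} :
    Close U (mk H 0) q ↔ q ∈ mk H '' (H + U) := by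
  constructor
  · rintro ⟨x, y, hx, rfl, hxy⟩
    obtain ⟨h, hh, rfl⟩ := (mk_eq_mk hH).1 hx.symm
    rw [zero_add'] at hxy
    exact ⟨y, ⟨h, hh, _, hxy, add_neg_cancel_left' h y⟩, rfl⟩
  · rintro ⟨_, ⟨h, hh, u, hu, rfl⟩, rfl⟩
    refine ⟨h, h + u, ?_, rfl, ?_⟩
    · rw [← mk_add_of_mem hH 0 hh, zero_add']
    · rwa [neg_add_cancel_left']

theorem close_of_mem {U : Set G} {u : G} (hu : u ∈ U) :
    Close U (mk H 0) (mk H u) :=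
  ⟨0, u, rfl, rfl, by rwa [neg_zero', zero_add']⟩

variable [TopologicalSpace G]

theorem isQuotientMap_mk : IsQuotientMap (mk H) := isQuotientMap_quotient_mk'

theorem continuous_mk : Continuous (mk H) := isQuotientMap_mk.continuous

/-- The balls about the base coset form a neighbourhood base, by inner neutrality. -/
theorem exists_close_subset (hH : IsStrongSubgyrogroup H) (hneutral : IsInnerNeutral H)
    {𝒰 : Set (Set G)} (hbase : ∀ N ∈ 𝓝 (0 : G), ∃ U ∈ 𝒰, U ⊆ N) {N : Set (CosetSpace H)}
    (hN : N ∈ 𝓝 (mk H 0)) : ∃ U ∈ 𝒰, ∀ q, Close U (mk H 0) q → q ∈ N := by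
  obtain ⟨W, hWN, hW, h0W⟩ := mem_nhds_iff.1 (continuous_mk.continuousAt.preimage_mem_nhds hN)
  obtain ⟨V, hV, h0V, hVW⟩ := hneutral W hW h0W
  obtain ⟨U, hU, hUV⟩ := hbase V (hV.mem_nhds h0V)
  refine ⟨U, hU, fun q hq => ?_⟩
  obtain ⟨x, hx, rfl⟩ := (close_zero_iff hH).1 hq
  obtain ⟨w, hw, h, hh, rfl⟩ := hVW (add_subset_add_left hUV hx)
  change mk H (w + h) ∈ N
  rw [mk_add_of_mem hH w hh]
  exact hWN hw

variable [IsStronglyTopologicalGyrogroup G]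

theorem continuous_add_left (g : G) : Continuous fun x : G => g + x :=
  IsTopologicalGyrogroup.continuous_add'.comp (by fun_prop : Continuous fun x : G => (g, x))

theorem continuous_add_right (g : G) : Continuous fun x : G => x + g :=
  IsTopologicalGyrogroup.continuous_add'.comp (by fun_prop : Continuous fun x : G => (x, g))

theorem isOpenMap_mk (hH : IsStrongSubgyrogroup H) : IsOpenMap (mk H) := by
  intro U hU
  have : mk H ⁻¹' (mk H '' U) = ⋃ h ∈ H, (fun x => x + h) ⁻¹' U := by
    ext x
    simp only [mem_preimage, mem_image, mem_iUnion, exists_prop]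
    constructor
    · rintro ⟨u, hu, hux⟩
      obtain ⟨h, hh, rfl⟩ := (mk_eq_mk hH).1 hux.symm
      exact ⟨h, hh, hu⟩
    · rintro ⟨h, hh, hu⟩
      exact ⟨_, hu, mk_add_of_mem hH x hh⟩
  rw [← isQuotientMap_mk.isOpen_preimage, this]
  exact isOpen_biUnion fun h _ => hU.preimage (continuous_add_right h)

theorem image_mk_mem_nhds (hH : IsStrongSubgyrogroup H) {V : Set G} {a : G} (hV : V ∈ 𝓝 a) :
    mk H '' V ∈ 𝓝 (mk H a) :=
  (isOpenMap_mk hH).image_mem_nhds hV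

theorem continuous_translate (hH : IsStrongSubgyrogroup H) (g : G) :
    Continuous (translate hH g) :=
  isQuotientMap_mk.continuous_iff.2 (continuous_mk.comp (continuous_add_left g))

theorem t1Space (hH : IsStrongSubgyrogroup H) (hclosed : IsClosed H) :
    T1Space (CosetSpace H) := by
  refine ⟨fun p => ?_⟩
  obtain ⟨a, rfl⟩ := mk_surjective p
  have : mk H ⁻¹' {mk H a} = (fun x => -a + x) ⁻¹' H := by
    ext x
    simp only [mem_preimage, mem_singleton_iff, eq_comm (a := mk H x), mk_eq_mk hH]
    constructor
    · rintro ⟨h, hh, rfl⟩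
      rwa [neg_add_cancel_left']
    · exact fun hx => ⟨_, hx, add_neg_cancel_left' a x⟩
  rw [← isQuotientMap_mk.isClosed_preimage, this]
  exact hclosed.preimage (continuous_add_left (-a))

/-- The group of self-homeomorphisms of the coset space preserving `U`-closeness for all members `U`
of `𝒰`. -/
def isometries (H : Set G) (𝒰 : Set (Set G)) : Subgroup (Equiv.Perm (CosetSpace H)) where
  carrier := {φ | Continuous φ ∧ Continuous (φ⁻¹ : Equiv.Perm _) ∧
    ∀ U ∈ 𝒰, ∀ p q, Close U (φ p) (φ q) ↔ Close U p q}
  one_mem' := ⟨continuous_id, continuous_id, fun _ _ _ _ => Iff.rfl⟩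
  mul_mem' := by
    rintro φ ψ ⟨h1, h2, h3⟩ ⟨k1, k2, k3⟩
    refine ⟨h1.comp k1, ?_, fun U hU p q => (h3 U hU _ _).trans (k3 U hU _ _)⟩
    rw [mul_inv_rev]
    exact k2.comp h2
  inv_mem' := by
    rintro φ ⟨h1, h2, h3⟩
    refine ⟨h2, by rwa [inv_inv], fun U hU p q => ?_⟩
    rw [← h3 U hU]
    simp

theorem translate_mem_isometries (hH : IsStrongSubgyrogroup H) {𝒰 : Set (Set G)}
    (h𝒰 : ∀ U ∈ 𝒰, ∀ x y : G, gyr x y '' U = U) (g : G) :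
    translate hH g ∈ isometries H 𝒰 := by
  have key : ∀ (g : G), ∀ U ∈ 𝒰, ∀ p q : CosetSpace H, Close U p q →
      Close U (translate hH g p) (translate hH g q) := by
    rintro g U hU _ _ ⟨x, y, rfl, rfl, hxy⟩
    refine ⟨g + x, g + y, rfl, rfl, ?_⟩
    rw [neg_add_add_add, ← h𝒰 U hU g x]
    exact mem_image_of_mem _ hxy
  refine ⟨continuous_translate hH g, ?_, fun U hU p q => ⟨fun h => ?_, key g U hU p q⟩⟩
  · rw [translate_inv]
    exact continuous_translate hH (-g)
  · have := key (-g) U hU _ _ h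
    rw [← translate_inv] at this
    simpa using this

theorem isNeutralAction (hH : IsStrongSubgyrogroup H) (hneutral : IsInnerNeutral H)
    {𝒰 : Set (Set G)} (hnhds : ∀ U ∈ 𝒰, U ∈ 𝓝 (0 : G))
    (hbase : ∀ N ∈ 𝓝 (0 : G), ∃ U ∈ 𝒰, U ⊆ N)
    (h𝒰 : ∀ U ∈ 𝒰, ∀ x y : G, gyr x y '' U = U) :
    IsNeutralAction (isometries H 𝒰) (mk H 0) := by
  have htr := translate_mem_isometries hH h𝒰
  have hadd : Continuous fun p : G × G => p.1 + p.2 := IsTopologicalGyrogroup.continuous_add'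
  have hsub : Continuous fun p : G × G => -p.1 + p.2 :=
    hadd.comp ((IsTopologicalGyrogroup.continuous_neg'.comp continuous_fst).prodMk continuous_snd)
  refine ⟨fun φ hφ => hφ.1, fun p => ?_, fun N hN => ?_, fun N hN => ?_, fun s N hN => ?_⟩
  · obtain ⟨a, rfl⟩ := mk_surjective p
    exact ⟨_, htr a, by rw [translate_mk, add_zero']⟩
  · have hpre : mk H ⁻¹' N ∈ 𝓝 ((0 : G) + 0) := by
      rw [zero_add']
      exact continuous_mk.continuousAt.preimage_mem_nhds hN
    obtain ⟨V, hV, W, hW, hVW⟩ := mem_nhds_prod_iff.1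
      ((hadd.tendsto ((0, 0) : G × G)).eventually_mem hpre)
    obtain ⟨U, hU, hUW⟩ := exists_close_subset hH hneutral hbase (image_mk_mem_nhds hH hW)
    refine ⟨mk H '' (V ∩ U), image_mk_mem_nhds hH (inter_mem hV (hnhds U hU)), ?_⟩
    rintro φ hφ ⟨v, ⟨hv, -⟩, hvφ⟩ _ ⟨u, ⟨-, hu⟩, rfl⟩
    -- `φ` need not be a translation: only closeness to `φ o = mk H v` is known, and translating by
    -- `-v` brings it back to the base coset.
    have h1 : Close U (φ (mk H 0)) (φ (mk H u)) := (hφ.2.2 U hU _ _).2 (close_of_mem hu)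
    have h2 : Close U (mk H 0) (translate hH (-v) (φ (mk H u))) := by
      have := ((htr (-v)).2.2 U hU _ _).2 h1
      rwa [← hvφ, translate_mk, neg_add'] at this
    obtain ⟨w, hw, hwφ⟩ := hUW _ h2
    have h3 : φ (mk H u) = mk H (v + w) := by
      rw [← translate_mk hH, hwφ, ← translate_inv]
      simp
    rw [h3]
    exact hVW (mk_mem_prod hv hw)
  · obtain ⟨U, hU, hUN⟩ := exists_close_subset hH hneutral hbase hN
    have hpre : U ∈ 𝓝 (-(0 : G) + 0) := by
      rw [neg_add']
      exact hnhds U hU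
    obtain ⟨V, hV, W, hW, hVW⟩ := mem_nhds_prod_iff.1
      ((hsub.tendsto ((0, 0) : G × G)).eventually_mem hpre)
    refine ⟨mk H '' (V ∩ W), image_mk_mem_nhds hH (inter_mem hV hW), ?_⟩
    rintro φ hφ ⟨v, ⟨hv, -⟩, hvφ⟩ _ ⟨w, ⟨-, hw⟩, rfl⟩
    -- Applying `φ` reduces closeness of `o` and `φ⁻¹ (mk H w)` to that of `mk H v` and `mk H w`.
    refine hUN _ ((hφ.2.2 U hU _ _).1 ?_)
    rw [← hvφ]
    refine ⟨v, w, rfl, by simp, hVW (mk_mem_prod hv hw)⟩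
  · obtain ⟨x, rfl⟩ := mk_surjective s
    have hpre : mk H ⁻¹' N ∈ 𝓝 (-(0 : G) + x) := by
      rw [neg_zero', zero_add']
      exact continuous_mk.continuousAt.preimage_mem_nhds hN
    obtain ⟨V, hV, W, hW, hVW⟩ := mem_nhds_prod_iff.1
      ((hsub.tendsto ((0, x) : G × G)).eventually_mem hpre)
    refine ⟨mk H '' V, image_mk_mem_nhds hH hV, ?_⟩
    rintro _ ⟨v, hv, rfl⟩
    refine ⟨_, htr (-v), by rw [translate_mk, neg_add'], ?_⟩
    exact hVW (mk_mem_prod hv (mem_of_mem_nhds hW))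

end CosetSpace

end Gyrogroup

theorem mainTheorem1 {G : Type*} [TopologicalSpace G] [T2Space G] [Gyrogroup G]
    [Gyrogroup.IsStronglyTopologicalGyrogroup G] (H : Set G)
    (hH : Gyrogroup.IsStrongSubgyrogroup H) (hclosed : IsClosed H)
    (hneutral : Gyrogroup.IsInnerNeutral H) :
    List.TFAE [
      FirstCountableTopology (Gyrogroup.CosetSpace H),
      IsBisequential (Gyrogroup.CosetSpace H),
      IsWeaklyFirstCountable (Gyrogroup.CosetSpace H),
      IsCsfCountable (Gyrogroup.CosetSpace H) ∧ SequentialSpace (Gyrogroup.CosetSpace H) ∧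
        IsAlphaSeven (Gyrogroup.CosetSpace H)] := by
  obtain ⟨𝒰, hnhds, hbase, h𝒰⟩ :=
    Gyrogroup.IsStronglyTopologicalGyrogroup.exists_invariant_base (G := G)
  have := Gyrogroup.CosetSpace.t1Space hH hclosed
  exact (Gyrogroup.CosetSpace.isNeutralAction hH hneutral hnhds hbase h𝒰).tfae
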